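/- Notation. Let $\widehat{\mathbb Z}=\prod_p\mathbb Z_p$ (product over all primes, with the product topology), and let $\mathbb A_f$ be the ring of finite adeles of $\mathbb Q$, i.e. the restricted product of the fields $\mathbb Q_p$ with respect to the subrings $\mathbb Z_p$, with the restricted product topology; thus $\widehat{\mathbb Z}\subset\mathbb A_f$. Let $\pi_p$ denote the projection onto the $p$-th component and $v_p$ the $p$-adic valuation, with $v_p(0)=+\infty$. For $\underline E=\prod_p E_p\subseteq\widehat{\mathbb Z}$ put $$\mathrm{Int}_{\mathbb A_f}(\underline E,\widehat{\mathbb Z})=\{g\in\mathbb A_f[x]\;:\;g(\underline E)\subseteq\widehat{\mathbb Z}\}.$$ An adelic ordering of $\underline E$ is a sequence $(\alpha_n)_{n\ge 0}$ of elements of $\underline E$ such that for every $n\ge 1$: (a) for every prime $p$, $\;v_p\big(\pi_p\big(\prod_{k=0}^{n-1}(\alpha_n-\alpha_k)\big)\big)=\min_{y\in\underline E}v_p\big(\pi_p\big(\prod_{k=0}^{n-1}(y-\alpha_k)\big)\big)$; (b) $v_p\big(\pi_p\big(\prod_{k=0}^{n-1}(\alpha_n-\alpha_k)\big)\big)=0$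 for all but finitely many primes $p$. Theorem. Let $\underline E=\prod_p E_p$ be a compact subset of $\widehat{\mathbb Z}$, with $E_p\subseteq\mathbb Z_p$, such that every $E_p$ is infinite and, for each $n\ge 0$, the image of $E_p$ in $\mathbb Z_p/p\mathbb Z_p$ has more than $n$ elements for all but finitely many primes $p$. Then an adelic ordering of $\underline E$ exists. Moreover, for every adelic ordering $(\alpha_n)_{n\ge0}$ of $\underline E$, the following hold. 1) The differences $\alpha_n-\alpha_k$ ($k<n$) are units of $\mathbb A_f$, and the polynomials $$g_n(x)=\prod_{k=0}^{n-1}\frac{x-\alpha_k}{\alpha_n-\alpha_k}\in\mathbb A_f[x]\qquad(n\ge 0)$$ form a basis of the $\widehat{\mathbb Z}$-module $\mathrm{Int}_{\mathbb A_f}(\underline E,\widehat{\mathbb Z})$. 2) Every $\varphi=(\varphi_p)_p\in\prod_p\mathcal C(E_p,\mathbb Z_p)$, regarded as the function $\underline E\to\widehat{\mathbb Z}$, $(y_p)_p\mapsto(\varphi_p(y_p))_p$, can be written in exactly one way as a series, uniformly convergent on $\underline E$, $$\varphi(x)=\sum_{n\ge 0}c_n\,g_n(x),\qquad c_n\in\widehat{\mathbb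 Z},\quad \lim_{n\to\infty}c_n=0 .$$ 3) These coefficients satisfy, for all $n\ge 0$, $$c_n=\varphi(\alpha_n)-\sum_{k=0}^{n-1}c_k\,g_k(\alpha_n),$$ and, for every prime $p$, $$\inf_{n\ge 0}v_p(\pi_p(c_n))=\inf_{y\in\underline E}v_p(\pi_p(\varphi(y))).$$ -/

import Mathlib

open Filter Topology Polynomial

namespace AdelicBK

noncomputable section

instance factPrime (p : Nat.Primes) : Fact (Nat.Prime (p : ℕ)) := ⟨p.2⟩

/-- The ring of profinite integers, `ℤ̂ = ∏_p ℤ_p`, with the product topology. -/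
abbrev ZHat : Type := ∀ p : Nat.Primes, ℤ_[p]

/-- The ring of finite adeles of `ℚ`: the restricted product of the fields `ℚ_p` with respect to
the subrings `ℤ_p`, with the restricted product topology. -/
abbrev FinAdeles : Type :=
  RestrictedProduct (fun p : Nat.Primes => ℚ_[p]) (fun p => (PadicInt.subring (p : ℕ) : Set ℚ_[p]))
    cofinite

/-- The canonical inclusion `ℤ̂ → 𝔸_f`. -/
def incl : ZHat →+* FinAdeles where
  toFun x := ⟨fun p => (x p : ℚ_[p]), Eventually.of_forall fun p => (x p).2⟩
  map_one' := rfl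
  map_mul' _ _ := rfl
  map_zero' := rfl
  map_add' _ _ := rfl

/-- `𝔸_f` (hence also `𝔸_f[x]`) as a `ℤ̂`-module. -/
instance : Algebra ZHat FinAdeles := incl.toAlgebra

/-- The subrings `ℤ_p ⊆ ℚ_p` are open; this makes `𝔸_f` a topological ring. -/
instance : Fact (∀ p : Nat.Primes, IsOpen (PadicInt.subring (p : ℕ) : Set ℚ_[p])) :=
  ⟨fun p => by
    have h := (PadicInt.isOpenEmbedding_coe (p := (p : ℕ))).isOpen_range
    rwa [Subtype.range_coe_subtype] at h⟩

/-- The uniform structure of the additive topological group `𝔸_f`. -/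
instance : UniformSpace FinAdeles := IsTopologicalAddGroup.rightUniformSpace FinAdeles

instance : IsUniformAddGroup FinAdeles := isUniformAddGroup_of_addCommGroup

/-- The product `∏_p E_p` as a subset of `ℤ̂`. -/
abbrev prodSet (E : ∀ p : Nat.Primes, Set ℤ_[p]) : Set ZHat := Set.univ.pi E

/-- The `p`-adic valuation on `ℤ_p`: the largest `k` with `p ^ k ∣ x`, and `v_p(0) = ∞`. -/
def vp (p : Nat.Primes) (x : ℤ_[p]) : ℕ∞ := emultiplicity ((p : ℕ) : ℤ_[p]) x

/-- `α` is an adelic ordering of `∏_p E_p`. -/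
structure IsAdelicOrdering (E : ∀ p : Nat.Primes, Set ℤ_[p]) (α : ℕ → ZHat) : Prop where
  mem : ∀ n, α n ∈ prodSet E
  isLeast : ∀ (p : Nat.Primes) (n : ℕ), 1 ≤ n →
    IsLeast ((fun y : ZHat => vp p ((∏ k ∈ Finset.range n, (y - α k)) p)) '' prodSet E)
      (vp p ((∏ k ∈ Finset.range n, (α n - α k)) p))
  eventually_zero : ∀ n : ℕ, 1 ≤ n →
    ∀ᶠ p : Nat.Primes in cofinite, vp p ((∏ k ∈ Finset.range n, (α n - α k)) p) = 0

/-- `Int_{𝔸_f}(∏_p E_p, ℤ̂)`: the `ℤ̂`-module of the polynomials `g ∈ 𝔸_f[x]` with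
`g(∏_p E_p) ⊆ ℤ̂`. -/
def intPoly (E : ∀ p : Nat.Primes, Set ℤ_[p]) : Submodule ZHat FinAdeles[X] where
  carrier := {g | ∀ y ∈ prodSet E, g.eval (incl y) ∈ Set.range incl}
  zero_mem' := fun y _ => ⟨0, by simp⟩
  add_mem' := by
    intro f g hf hg y hy
    obtain ⟨a, ha⟩ := hf y hy
    obtain ⟨b, hb⟩ := hg y hy
    exact ⟨a + b, by rw [map_add, ha, hb, eval_add]⟩
  smul_mem' := by
    intro c g hg y hy
    obtain ⟨a, ha⟩ := hg y hy
    exact ⟨c * a, by rw [map_mul, ha, eval_smul, Algebra.smul_def]; rfl⟩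

/-- The polynomial `g_n(x) = ∏_{k<n} (x - α_k) / (α_n - α_k)` of `𝔸_f[x]`. The inverse is the one
of the ring `𝔸_f`, meaningful when the differences `α_n - α_k` are units of `𝔸_f`. -/
def orderingPoly (α : ℕ → ZHat) (n : ℕ) : FinAdeles[X] :=
  ∏ k ∈ Finset.range n, C (Ring.inverse (incl (α n) - incl (α k))) * (X - C (incl (α k)))

/-- The function `∏_p E_p → ℤ̂` given by a family of functions `φ_p ∈ C(E_p, ℤ_p)`. -/
def prodFun {E : ∀ p : Nat.Primes, Set ℤ_[p]} (φ : ∀ p : Nat.Primes, C(E p, ℤ_[p]))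
    (y : prodSet E) : ZHat :=
  fun p => φ p ⟨(y : ZHat) p, y.2 p (Set.mem_univ p)⟩

/-- `c_n → 0` in `ℤ̂`, and `∑ c_n g_n`, with `g_n` attached to `α`, converges uniformly to `φ` on
`∏_p E_p`. -/
structure IsExpansion {E : ∀ p : Nat.Primes, Set ℤ_[p]} (α : ℕ → ZHat)
    (φ : ∀ p : Nat.Primes, C(E p, ℤ_[p])) (c : ℕ → ZHat) : Prop where
  tendsto_zero : Tendsto c atTop (𝓝 0)
  tendstoUniformly : TendstoUniformly
    (fun (N : ℕ) (y : prodSet E) =>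
      ∑ n ∈ Finset.range N, c n • (orderingPoly α n).eval (incl (y : ZHat)))
    (fun y : prodSet E => incl (prodFun φ y)) atTop

end

end AdelicBK

/-! At each prime p the minimality condition says that ∏_{k<n}(α_n - α_k) has the least valuation
among the products ∏_{k<n}(y - α_k), y in E_p. It therefore divides them in ℤ_p, and g_n is integral
on E_p (`exists_eval_eq`). Condition (b) and the infinitude of each E_p make the differences units
of 𝔸_f.

Since g_n(α_m) = 0 for m < n and g_n(α_n) = 1, evaluation along α turns an expansion into a
unitriangular system over ℤ̂. This gives the basis, the recursion and the uniqueness of the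
coefficients; any ideal that contains all the values contains all the coefficients
(`mem_of_triangular`).

For convergence, fix p and k. Modulo p^k, a continuous function on E_p extends to ℤ_p, where
Mahler's theorem approximates it by a polynomial; the latter is a finite integral combination of the
g_n. By triangularity, the coefficients of φ agree modulo p^k with that finite combination
(`exists_forall_pow_dvd_newton`). No uniformity in p is needed, as ℤ̂ carries the product topology.
-/

namespace AdelicBK

noncomputable section

/-! ### Newton interpolation over a general ring extension -/

section Newton

variable {R : Type*} (K : Type*) [CommRing R] [CommRing K] [Algebra R K]

/-- The Newton interpolation polynomial `∏_{k<n} (x - a_k) / (a_n - a_k)` over `K`, attached to a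
sequence of elements of `R`. -/
def newtonPoly (a : ℕ → R) (n : ℕ) : K[X] :=
  ∏ k ∈ Finset.range n, C (Ring.inverse (algebraMap R K (a n) - algebraMap R K (a k))) *
    (X - C (algebraMap R K (a k)))

variable {K} {a : ℕ → R}

theorem eval_newtonPoly_of_lt {m n : ℕ} (h : m < n) :
    (newtonPoly K a n).eval (algebraMap R K (a m)) = 0 := by
  rw [newtonPoly, eval_prod]
  exact Finset.prod_eq_zero (Finset.mem_range.2 h) (by simp)

theorem eval_newtonPoly_mul
    (hu : ∀ n, ∀ k < n, IsUnit (algebraMap R K (a n) - algebraMap R K (a k))) (n : ℕ) (y : K) :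
    (newtonPoly K a n).eval y *
      ∏ k ∈ Finset.range n, (algebraMap R K (a n) - algebraMap R K (a k)) =
      ∏ k ∈ Finset.range n, (y - algebraMap R K (a k)) := by
  rw [newtonPoly, eval_prod, ← Finset.prod_mul_distrib]
  refine Finset.prod_congr rfl fun k hk => ?_
  have := Ring.inverse_mul_cancel _ (hu n k (Finset.mem_range.1 hk))
  simp only [eval_mul, eval_C, eval_sub, eval_X]
  rw [mul_right_comm, this, one_mul]

theorem isUnit_prod_sub
    (hu : ∀ n, ∀ k < n, IsUnit (algebraMap R K (a n) - algebraMap R K (a k))) (n : ℕ) :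
    IsUnit (∏ k ∈ Finset.range n, (algebraMap R K (a n) - algebraMap R K (a k))) :=
  (IsUnit.prod_iff).2 fun k hk => hu n k (Finset.mem_range.1 hk)

theorem eval_newtonPoly_self
    (hu : ∀ n, ∀ k < n, IsUnit (algebraMap R K (a n) - algebraMap R K (a k))) (n : ℕ) :
    (newtonPoly K a n).eval (algebraMap R K (a n)) = 1 :=
  (isUnit_prod_sub hu n).mul_right_cancel (by rw [eval_newtonPoly_mul hu, one_mul])

theorem C_prod_sub_mul_newtonPoly
    (hu : ∀ n, ∀ k < n, IsUnit (algebraMap R K (a n) - algebraMap R K (a k))) (n : ℕ) :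
    C (∏ k ∈ Finset.range n, (algebraMap R K (a n) - algebraMap R K (a k))) * newtonPoly K a n =
      ∏ k ∈ Finset.range n, (X - C (algebraMap R K (a k))) := by
  rw [newtonPoly, map_prod, ← Finset.prod_mul_distrib]
  refine Finset.prod_congr rfl fun k hk => ?_
  rw [← mul_assoc, ← C_mul, Ring.mul_inverse_cancel _ (hu n k (Finset.mem_range.1 hk)), C_1,
    one_mul]

/-- The Newton polynomials of index less than `d` span the polynomials of degree less than `d`. -/
theorem exists_eq_sum_newtonPoly [Nontrivial K]
    (hu : ∀ n, ∀ k < n, IsUnit (algebraMap R K (a n) - algebraMap R K (a k))) (d : ℕ) (f : K[X])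
    (hf : f.degree < d) :
    ∃ b : ℕ → K, f = ∑ n ∈ Finset.range d, C (b n) * newtonPoly K a n := by
  induction d generalizing f with
  | zero => exact ⟨0, by simpa using hf⟩
  | succ d ih =>
    set M : K[X] := ∏ k ∈ Finset.range d, (X - C (algebraMap R K (a k))) with hM
    have hmonic : M.Monic := monic_prod_of_monic _ _ fun k _ => monic_X_sub_C _
    have hdeg : M.natDegree = d := by
      rw [hM, natDegree_prod_of_monic _ _ fun k _ => monic_X_sub_C _]
      simp
    -- `M` is monic of degree `d`, so this subtraction removes the term of degree `d`.
    obtain ⟨b, hb⟩ := ih (f - C (f.coeff d) * M) (by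
      rw [degree_lt_iff_coeff_zero] at hf ⊢
      intro m hm
      rw [coeff_sub, coeff_C_mul]
      rcases hm.eq_or_lt with rfl | hm
      · have : M.coeff d = 1 := by rw [← hmonic.coeff_natDegree, hdeg]
        rw [this, mul_one, sub_self]
      · rw [hf m hm, coeff_eq_zero_of_natDegree_lt (p := M) (by rwa [hdeg]), mul_zero, sub_self])
    -- The factor after `f.coeff d` undoes the normalisation of the `d`-th Newton polynomial.
    refine ⟨Function.update b d (f.coeff d *
      ∏ k ∈ Finset.range d, (algebraMap R K (a d) - algebraMap R K (a k))), ?_⟩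
    rw [Finset.sum_range_succ, Function.update_self, C_mul, mul_assoc,
      C_prod_sub_mul_newtonPoly hu, ← hM, ← sub_eq_iff_eq_add, hb]
    refine Finset.sum_congr rfl fun n hn => ?_
    rw [Function.update_of_ne (Finset.mem_range.1 hn).ne]

theorem sum_mul_eval_newtonPoly
    (hu : ∀ n, ∀ k < n, IsUnit (algebraMap R K (a n) - algebraMap R K (a k))) (b : ℕ → K)
    {d n : ℕ} (hn : n < d) :
    ∑ k ∈ Finset.range d, b k * (newtonPoly K a k).eval (algebraMap R K (a n)) =
      ∑ k ∈ Finset.range n, b k * (newtonPoly K a k).eval (algebraMap R K (a n)) + b n := by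
  rw [← Finset.sum_subset (Finset.range_subset_range.2 hn), Finset.sum_range_succ,
    eval_newtonPoly_self hu, mul_one]
  intro k _ hk
  rw [eval_newtonPoly_of_lt (by simpa using hk), mul_zero]

variable {S : Set R}

/-- A polynomial with `R`-integral values on `S` is an `R`-combination of the Newton polynomials,
if these have integral values on `S`. -/
theorem exists_eq_sum_smul_newtonPoly [Nontrivial K]
    (hu : ∀ n, ∀ k < n, IsUnit (algebraMap R K (a n) - algebraMap R K (a k)))
    (ha : ∀ n, a n ∈ S)
    (hint : ∀ n, ∀ y ∈ S, (newtonPoly K a n).eval (algebraMap R K y) ∈ (algebraMap R K).range)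
    (f : K[X]) (hf : ∀ y ∈ S, f.eval (algebraMap R K y) ∈ (algebraMap R K).range) :
    ∃ (d : ℕ) (b : ℕ → R), f = ∑ n ∈ Finset.range d, b n • newtonPoly K a n := by
  set d := f.natDegree + 1
  have hd : f.degree < d := degree_le_natDegree.trans_lt (by exact_mod_cast Nat.lt_succ_self _)
  obtain ⟨b, hb⟩ := exists_eq_sum_newtonPoly hu d f hd
  -- Evaluation at `a n` kills the terms beyond `n`, so `b n` is an integral value minus earlier,
  -- inductively integral, terms.
  have hval : ∀ n < d, b n ∈ (algebraMap R K).range := by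
    intro n
    induction n using Nat.strong_induction_on with
    | _ n ih =>
      intro hn
      have h1 := hf _ (ha n)
      rw [hb, eval_finsetSum] at h1
      simp only [eval_mul, eval_C] at h1
      rw [sum_mul_eval_newtonPoly hu b hn] at h1
      have h2 : ∑ k ∈ Finset.range n, b k * (newtonPoly K a k).eval (algebraMap R K (a n)) ∈
          (algebraMap R K).range := sum_mem fun k hk =>
        mul_mem (ih k (Finset.mem_range.1 hk) ((Finset.mem_range.1 hk).trans hn)) (hint k _ (ha n))
      simpa using sub_mem h1 h2
  choose! c hc using hval
  refine ⟨d, c, ?_⟩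
  conv_lhs => rw [hb]
  refine Finset.sum_congr rfl fun n hn => ?_
  rw [← hc n (Finset.mem_range.1 hn), algebra_compatible_smul K, smul_eq_C_mul]

/-- If `n` is the least index with a nonzero coefficient, evaluating the relation at `a n` leaves
that coefficient alone. -/
theorem linearIndependent_newtonPoly
    (hu : ∀ n, ∀ k < n, IsUnit (algebraMap R K (a n) - algebraMap R K (a k)))
    (hinj : Function.Injective (algebraMap R K)) :
    LinearIndependent R (newtonPoly K a) := by
  rw [linearIndependent_iff']
  intro s c hc
  by_contra! hne
  have hex : ∃ n, n ∈ s ∧ c n ≠ 0 := hne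
  classical
  obtain ⟨hs, hn⟩ := Nat.find_spec hex
  set n := Nat.find hex
  refine hn (hinj ?_)
  have h := congrArg (eval (algebraMap R K (a n))) hc
  rw [eval_finsetSum, Finset.sum_eq_single n] at h
  · simpa [algebra_compatible_smul K, eval_newtonPoly_self hu] using h
  · intro k hk hkn
    rcases lt_or_gt_of_ne hkn with hlt | hlt
    · have : c k = 0 := by
        by_contra h0
        exact Nat.find_min hex hlt ⟨hk, h0⟩
      simp [this]
    · rw [eval_smul, eval_newtonPoly_of_lt hlt, smul_zero]
  · exact fun h => absurd hs h

end Newton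

/-! ### Unitriangular systems -/

section Coefficients

variable {R : Type*} [CommRing R]

/-- The solution of the triangular system `v n = ∑_{k<n} c k * t k n + c n`. -/
def newtonCoeff (t : ℕ → ℕ → R) (v : ℕ → R) (n : ℕ) : R :=
  v n - ∑ k : Fin n, newtonCoeff t v k * t k n

theorem newtonCoeff_eq (t : ℕ → ℕ → R) (v : ℕ → R) (n : ℕ) :
    newtonCoeff t v n = v n - ∑ k ∈ Finset.range n, newtonCoeff t v k * t k n := by
  rw [newtonCoeff, Finset.sum_range fun k => newtonCoeff t v k * t k n]

/-- Applied with `I` generated by a power of p, to carry divisibility from values to coefficients.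
-/
theorem mem_of_triangular {t : ℕ → ℕ → R} {v c : ℕ → R} {I : Ideal R}
    (hc : ∀ n, c n = v n - ∑ k ∈ Finset.range n, c k * t k n) (hv : ∀ n, v n ∈ I) (n : ℕ) :
    c n ∈ I := by
  induction n using Nat.strong_induction_on with
  | _ n ih =>
    rw [hc]
    exact sub_mem (hv n) (sum_mem fun k hk => I.mul_mem_right _ (ih k (Finset.mem_range.1 hk)))

end Coefficients

/-! ### Approximation and expansion at one prime -/

section Local

variable {p : ℕ} [Fact p.Prime]

theorem pow_dvd_iff_norm_le (x : ℤ_[p]) (n : ℕ) :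
    (p : ℤ_[p]) ^ n ∣ x ↔ ‖x‖ ≤ (p : ℝ) ^ (-n : ℤ) := by
  rw [PadicInt.norm_le_pow_iff_mem_span_pow, Ideal.mem_span_singleton]

/-- A continuous function on a compact subset of `ℤ_p` agrees modulo `p ^ k` with a continuous
function on `ℤ_p`. -/
theorem exists_continuous_extension {S : Set ℤ_[p]} (hS : IsCompact S) (φ : C(S, ℤ_[p]))
    (k : ℕ) : ∃ ψ : C(ℤ_[p], ℤ_[p]), ∀ y : S, (p : ℤ_[p]) ^ k ∣ φ y - ψ y := by
  have : CompactSpace S := isCompact_iff_compactSpace.1 hS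
  have hp : (0 : ℝ) < p := by exact_mod_cast (Fact.out : p.Prime).pos
  obtain ⟨δ, hδ, hφ⟩ := φ.uniform_continuity ((p : ℝ) ^ (-k : ℤ)) (by positivity)
  obtain ⟨m, hm⟩ := PadicInt.exists_pow_neg_lt p hδ
  classical
  -- On a residue class meeting `S`, the extension is the value of `φ` at one chosen point of the
  -- class; on the other classes it is 0.
  let r : ZMod (p ^ m) → ℤ_[p] := fun z =>
    if h : ∃ y : S, PadicInt.toZModPow m (y : ℤ_[p]) = z then φ h.choose else 0
  have hker : ∀ x y : ℤ_[p], PadicInt.toZModPow m x = PadicInt.toZModPow m y ↔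
      ‖x - y‖ ≤ (p : ℝ) ^ (-m : ℤ) := fun x y => by
    rw [PadicInt.norm_le_pow_iff_mem_span_pow, ← PadicInt.ker_toZModPow, RingHom.mem_ker, map_sub,
      sub_eq_zero]
  have hloc : IsLocallyConstant fun x : ℤ_[p] => r (PadicInt.toZModPow m x) := by
    rw [IsLocallyConstant.iff_eventually_eq]
    intro x
    filter_upwards [Metric.ball_mem_nhds x (show (0 : ℝ) < (p : ℝ) ^ (-m : ℤ) by positivity)]
      with y hy
    rw [(hker y x).2 (by simpa [dist_eq_norm] using (Metric.mem_ball.1 hy).le)]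
  refine ⟨⟨_, hloc.continuous⟩, fun y => ?_⟩
  have h : ∃ z : S, PadicInt.toZModPow m (z : ℤ_[p]) = PadicInt.toZModPow m (y : ℤ_[p]) := ⟨y, rfl⟩
  have hr : r (PadicInt.toZModPow m (y : ℤ_[p])) = φ h.choose := dif_pos h
  change _ ∣ φ y - r (PadicInt.toZModPow m (y : ℤ_[p]))
  rw [hr, pow_dvd_iff_norm_le, ← dist_eq_norm]
  refine (hφ ?_).le
  rw [Subtype.dist_eq, dist_eq_norm]
  exact ((hker _ _).1 h.choose_spec.symm).trans_lt hm

theorem exists_poly_choose (k : ℕ) : ∃ f : ℚ_[p][X], ∀ x : ℤ_[p],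
    f.eval (x : ℚ_[p]) = ((Ring.choose x k : ℤ_[p]) : ℚ_[p]) := by
  refine ⟨C ((k.factorial : ℚ_[p])⁻¹) * (descPochhammer ℤ_[p] k).map (algebraMap ℤ_[p] ℚ_[p]),
    fun x => ?_⟩
  have h0 : (k.factorial : ℚ_[p]) ≠ 0 := by exact_mod_cast k.factorial_ne_zero
  have h := Ring.descPochhammer_eq_factorial_smul_choose x k
  rw [← aeval_eq_smeval, aeval_def, ← eval_map, descPochhammer_map, nsmul_eq_mul] at h
  rw [eval_mul, eval_C, inv_mul_eq_iff_eq_mul₀ h0]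
  change eval (algebraMap ℤ_[p] ℚ_[p] x) _ = _
  rw [eval_map_apply, h]
  simp [PadicInt.algebraMap_apply]

/-- Continuous functions on `ℤ_p` are uniform limits of polynomials over `ℚ_p`. -/
theorem exists_poly_approx (ψ : C(ℤ_[p], ℤ_[p])) (k : ℕ) : ∃ f : ℚ_[p][X], ∀ x : ℤ_[p],
    ∃ z : ℤ_[p], f.eval (x : ℚ_[p]) = z ∧ (p : ℤ_[p]) ^ k ∣ ψ x - z := by
  have hp : (0 : ℝ) < p := by exact_mod_cast (Fact.out : p.Prime).pos
  have h := (PadicInt.hasSum_mahler ψ).tendsto_sum_nat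
  rw [Metric.tendsto_atTop] at h
  obtain ⟨N, hN⟩ := h ((p : ℝ) ^ (-k : ℤ)) (by positivity)
  choose f hf using exists_poly_choose (p := p)
  refine ⟨∑ n ∈ Finset.range N, f n * C (((fwdDiff (1 : ℤ_[p]))^[n] ψ 0 : ℤ_[p]) : ℚ_[p]), fun x =>
    ⟨∑ n ∈ Finset.range N, Ring.choose x n * (fwdDiff (1 : ℤ_[p]))^[n] ψ 0, ?_, ?_⟩⟩
  · rw [eval_finsetSum, PadicInt.coe_sum]
    exact Finset.sum_congr rfl fun n _ => by rw [eval_mul, eval_C, hf, PadicInt.coe_mul]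
  · rw [pow_dvd_iff_norm_le]
    have h1 := (ContinuousMap.dist_apply_le_dist x).trans (hN N le_rfl).le
    rw [dist_comm, dist_eq_norm, ContinuousMap.sum_apply] at h1
    simpa only [PadicInt.mahlerTerm_apply, mahler_apply, smul_eq_mul] using h1

variable {S : Set ℤ_[p]} {a : ℕ → ℤ_[p]} {q : ℕ → ℤ_[p] → ℤ_[p]}

/-- Continuous functions on a compact set `S ⊆ ℤ_p` are approximated by combinations of the
Newton quotients `q n y = ∏_{k<n} (y - a_k) / (a_n - a_k)`, if these are integral on `S`. -/
theorem exists_newton_approx (hS : IsCompact S) (ha : ∀ n, a n ∈ S)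
    (hne : ∀ n, ∀ k < n, a n ≠ a k)
    (hq : ∀ n, ∀ y ∈ S, q n y * ∏ k ∈ Finset.range n, (a n - a k) =
      ∏ k ∈ Finset.range n, (y - a k))
    (φ : C(S, ℤ_[p])) (k : ℕ) : ∃ (d : ℕ) (b : ℕ → ℤ_[p]), ∀ y : S,
      (p : ℤ_[p]) ^ k ∣ φ y - ∑ n ∈ Finset.range d, b n * q n y := by
  have hu : ∀ n, ∀ k < n,
      IsUnit (algebraMap ℤ_[p] ℚ_[p] (a n) - algebraMap ℤ_[p] ℚ_[p] (a k)) := fun n k hk => by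
    rw [← map_sub, isUnit_iff_ne_zero, Ne, FaithfulSMul.algebraMap_eq_zero_iff, sub_eq_zero]
    exact hne n k hk
  have hval : ∀ n, ∀ y ∈ S, (newtonPoly ℚ_[p] a n).eval (algebraMap ℤ_[p] ℚ_[p] y) =
      algebraMap ℤ_[p] ℚ_[p] (q n y) := fun n y hy => by
    refine (isUnit_prod_sub hu n).mul_right_cancel ?_
    rw [eval_newtonPoly_mul hu]
    simp only [← map_sub, ← map_prod, ← map_mul, hq n y hy]
  obtain ⟨ψ, hψ⟩ := exists_continuous_extension hS φ k
  obtain ⟨f, hf⟩ := exists_poly_approx ψ k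
  obtain ⟨d, b, hb⟩ := exists_eq_sum_smul_newtonPoly hu ha
    (fun n y hy => ⟨q n y, (hval n y hy).symm⟩) f
    (fun y _ => let ⟨z, hz, _⟩ := hf y; ⟨z, hz.symm⟩)
  refine ⟨d, b, fun y => ?_⟩
  obtain ⟨z, hz, hdvd⟩ := hf y
  have hzs : z = ∑ n ∈ Finset.range d, b n * q n y := by
    apply FaithfulSMul.algebraMap_injective ℤ_[p] ℚ_[p]
    change (z : ℚ_[p]) = _
    rw [← hz, hb, eval_finsetSum, map_sum]
    refine Finset.sum_congr rfl fun n _ => ?_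
    change eval (algebraMap ℤ_[p] ℚ_[p] y) _ = _
    rw [algebra_compatible_smul ℚ_[p], eval_smul, hval n y y.2, smul_eq_mul, map_mul]
  rw [← hzs]
  simpa using dvd_add (hψ y) hdvd

/-- The remainders of the Newton expansion of a continuous function on `S` and its coefficients are
eventually divisible by a given power of `p`. -/
theorem exists_forall_pow_dvd_newton (hS : IsCompact S) (ha : ∀ n, a n ∈ S)
    (hne : ∀ n, ∀ k < n, a n ≠ a k)
    (hq : ∀ n, ∀ y ∈ S, q n y * ∏ k ∈ Finset.range n, (a n - a k) =
      ∏ k ∈ Finset.range n, (y - a k))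
    (φ : C(S, ℤ_[p])) {c : ℕ → ℤ_[p]}
    (hc : ∀ n, c n = φ ⟨a n, ha n⟩ - ∑ k ∈ Finset.range n, c k * q k (a n)) (k : ℕ) :
    ∃ d : ℕ, ∀ N ≥ d, (p : ℤ_[p]) ^ k ∣ c N ∧
      ∀ y : S, (p : ℤ_[p]) ^ k ∣ φ y - ∑ n ∈ Finset.range N, c n * q n y := by
  obtain ⟨d, b, hb⟩ := exists_newton_approx hS ha hne hq φ k
  have hprod : ∀ n, ∏ k ∈ Finset.range n, (a n - a k) ≠ 0 := fun n =>
    Finset.prod_ne_zero_iff.2 fun k hk => sub_ne_zero.2 (hne n k (Finset.mem_range.1 hk))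
  have hself : ∀ n, q n (a n) = 1 := fun n =>
    mul_right_cancel₀ (hprod n) (by rw [hq n _ (ha n), one_mul])
  have hlt : ∀ n, ∀ m < n, q n (a m) = 0 := fun n m hm =>
    mul_right_cancel₀ (hprod n) (by
      rw [hq n _ (ha m), zero_mul]
      exact Finset.prod_eq_zero (Finset.mem_range.2 hm) (sub_self _))
  -- With `b` cut off at `d`, the difference `c - e` solves the triangular system whose right-hand
  -- side is the approximation error, divisible by `p ^ k`.
  set e : ℕ → ℤ_[p] := fun n => if n < d then b n else 0 with he
  have hsum : ∀ N ≥ d, ∀ y, ∑ n ∈ Finset.range N, e n * q n y =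
      ∑ n ∈ Finset.range d, b n * q n y := fun N hN y => by
    rw [← Finset.sum_subset (Finset.range_subset_range.2 hN)]
    · exact Finset.sum_congr rfl fun n hn => by rw [he]; simp only [if_pos (Finset.mem_range.1 hn)]
    · intro n _ hn
      rw [he]
      simp only [if_neg (mt Finset.mem_range.2 hn), zero_mul]
  have htri : ∀ n, c n - e n = (φ ⟨a n, ha n⟩ - ∑ k ∈ Finset.range d, b k * q k (a n)) -
      ∑ k ∈ Finset.range n, (c k - e k) * q k (a n) := fun n => by
    have h1 : ∑ k ∈ Finset.range d, b k * q k (a n) =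
        ∑ k ∈ Finset.range n, e k * q k (a n) + e n := by
      rw [← hsum (max d (n + 1)) (le_max_left _ _),
        ← Finset.sum_subset (Finset.range_subset_range.2 (le_max_right d (n + 1))),
        Finset.sum_range_succ, hself, mul_one]
      intro k _ hk
      rw [hlt k n (by simpa using hk), mul_zero]
    simp only [sub_mul, Finset.sum_sub_distrib]
    rw [h1, hc n]
    ring
  have hdvd : ∀ n, (p : ℤ_[p]) ^ k ∣ c n - e n := fun n =>
    Ideal.mem_span_singleton.1 (mem_of_triangular (t := fun k n => q k (a n)) htri
      (fun n => Ideal.mem_span_singleton.2 (hb ⟨a n, ha n⟩)) n)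
  refine ⟨d, fun N hN => ⟨?_, fun y => ?_⟩⟩
  · simpa [he, hN.not_gt] using hdvd N
  · have h2 : φ y - ∑ n ∈ Finset.range N, c n * q n y =
        (φ y - ∑ n ∈ Finset.range d, b n * q n y) -
          ∑ n ∈ Finset.range N, (c n - e n) * q n y := by
      simp only [sub_mul, Finset.sum_sub_distrib]
      rw [hsum N hN]
      ring
    rw [h2]
    exact dvd_sub (hb y) (Finset.dvd_sum fun n _ => (hdvd n).mul_right _)

end Local

/-! ### Valuations and minimising sequences -/

section Valuation

variable {p : Nat.Primes}

theorem natCast_le_vp_iff (x : ℤ_[p]) (d : ℕ) : (d : ℕ∞) ≤ vp p x ↔ ((p : ℕ) : ℤ_[p]) ^ d ∣ x :=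
  pow_dvd_iff_le_emultiplicity.symm

theorem vp_eq_top_iff (x : ℤ_[p]) : vp p x = ⊤ ↔ x = 0 := by
  refine ⟨fun h => by_contra fun hx => ?_, fun h => by rw [h, vp, emultiplicity_zero]⟩
  exact finiteMultiplicity_iff_emultiplicity_ne_top.1
    (FiniteMultiplicity.of_prime_left PadicInt.prime_p hx) h

theorem vp_eq_zero_iff (x : ℤ_[p]) : vp p x = 0 ↔ IsUnit x := by
  rw [vp, emultiplicity_eq_zero, ← not_iff_not, not_not, PadicInt.not_isUnit_iff,
    PadicInt.norm_lt_one_iff_dvd]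

theorem dvd_of_vp_le {x y : ℤ_[p]} (hx : x ≠ 0) (h : vp p x ≤ vp p y) : x ∣ y := by
  rw [PadicInt.unitCoeff_spec hx, Units.mul_left_dvd]
  rw [← natCast_le_vp_iff]
  refine le_trans ?_ h
  rw [natCast_le_vp_iff]
  exact ⟨_, (PadicInt.unitCoeff_spec hx).trans (mul_comm _ _)⟩

/-- A sequence that minimises successively the valuations of the products of differences. -/
theorem exists_minimising_sequence {S : Set ℤ_[p]} (hS : S.Nonempty) :
    ∃ a : ℕ → ℤ_[p], (∀ n, a n ∈ S) ∧ ∀ n, ∀ y ∈ S,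
      vp p (∏ k ∈ Finset.range n, (a n - a k)) ≤ vp p (∏ k ∈ Finset.range n, (y - a k)) := by
  have step : ∀ (n : ℕ) (f : ∀ k < n, ℤ_[p]), ∃ x ∈ S, ∀ y ∈ S,
      vp p (∏ k : Fin n, (x - f k k.2)) ≤ vp p (∏ k : Fin n, (y - f k k.2)) := fun n f => by
    -- The minimum exists because `ℕ∞` is well ordered; compactness plays no role.
    obtain ⟨x, hx, h⟩ := exists_minimalFor_of_wellFoundedLT (· ∈ S)
      (fun y => vp p (∏ k : Fin n, (y - f k k.2))) hS
    exact ⟨x, hx, fun y hy => (le_total _ _).elim id (h hy)⟩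
  choose F hF hmin using step
  let a : ℕ → ℤ_[p] := fun n => Nat.strongRec (motive := fun _ => ℤ_[p]) F n
  have ha : ∀ n, a n = F n fun k _ => a k := fun n => Nat.strongRec_eq F n
  refine ⟨a, fun n => by rw [ha]; exact hF _ _, fun n y hy => ?_⟩
  have h := hmin n (fun k _ => a k) y hy
  rw [← ha n] at h
  rwa [Finset.prod_range fun k => a n - a k, Finset.prod_range fun k => y - a k]

end Valuation

/-! ### The inclusion of ℤ̂ in 𝔸_f and uniform convergence in products -/

section Topology

theorem incl_injective : Function.Injective incl := fun x y h => by
  funext p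
  exact Subtype.ext (congrArg (fun z : FinAdeles => z p) h)

theorem continuous_incl : Continuous incl :=
  (RestrictedProduct.isEmbedding_structureMap (R := fun p : Nat.Primes => ℚ_[p])
    (A := fun p => (PadicInt.subring (p : ℕ) : Set ℚ_[p])) (𝓕 := cofinite)).continuous

theorem uniformContinuous_incl : UniformContinuous incl :=
  uniformContinuous_addMonoidHom_of_continuous (f := incl) continuous_incl

theorem tendstoUniformly_pi_iff {ι κ X : Type*} {A : κ → Type*} [∀ i, UniformSpace (A i)]
    {l : Filter ι} {F : ι → X → ∀ i, A i} {f : X → ∀ i, A i} :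
    TendstoUniformly F f l ↔ ∀ i, TendstoUniformly (fun n x => F n x i) (fun x => f x i) l := by
  simp only [tendstoUniformly_iff_tendsto, Pi.uniformity, tendsto_iInf, tendsto_comap_iff,
    Function.comp_def]

end Topology

/-! ### Adelic orderings and their expansions -/

section Ordering

variable {E : ∀ p : Nat.Primes, Set ℤ_[p]}

/-- The primes are treated independently. If `E p` meets more than `n` residue classes, some `y`
avoids those of the first `n` terms; its product is a unit, so the minimum is 0. -/
theorem exists_isAdelicOrdering (hinf : ∀ p : Nat.Primes, (E p).Infinite)
    (hmod : ∀ n : ℕ, ∀ᶠ p : Nat.Primes in cofinite,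
      n < ((PadicInt.toZMod (p := (p : ℕ))) '' E p).ncard) :
    ∃ α : ℕ → ZHat, IsAdelicOrdering E α := by
  choose a hmem hmin using fun p => exists_minimising_sequence (hinf p).nonempty
  refine ⟨fun n p => a p n, fun n p _ => hmem p n, fun p n _ => ⟨⟨_, fun p _ => hmem p n, rfl⟩, ?_⟩,
    fun n _ => ?_⟩
  · rintro _ ⟨y, hy, rfl⟩
    simpa only [Finset.prod_apply, Pi.sub_apply] using hmin p n (y p) (hy p trivial)
  · filter_upwards [hmod n] with p hp
    let T : Finset (ZMod p) := (Finset.range n).image fun k => PadicInt.toZMod (a p k)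
    obtain ⟨_, ⟨y, hy, rfl⟩, hyT⟩ : ∃ z ∈ (PadicInt.toZMod (p := (p : ℕ))) '' E p, z ∉ T := by
      by_contra! hsub
      have h1 := Set.ncard_le_ncard (t := (T : Set (ZMod p))) hsub T.finite_toSet
      rw [Set.ncard_coe_finset] at h1
      have h2 : T.card ≤ n := Finset.card_image_le.trans (Finset.card_range n).le
      omega
    have h0 : vp p (∏ k ∈ Finset.range n, (y - a p k)) = 0 := by
      rw [vp_eq_zero_iff, IsUnit.prod_iff]
      intro k hk
      by_contra hu
      have : y - a p k ∈ RingHom.ker (PadicInt.toZMod (p := (p : ℕ))) := by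
        rw [PadicInt.ker_toZMod]
        exact hu
      rw [RingHom.mem_ker, map_sub, sub_eq_zero] at this
      exact hyT (Finset.mem_image.2 ⟨k, hk, this.symm⟩)
    have h := hmin p n y hy
    rw [h0, nonpos_iff_eq_zero] at h
    simpa only [Finset.prod_apply, Pi.sub_apply] using h

namespace IsAdelicOrdering

variable {α : ℕ → ZHat}

theorem vp_prod_le (hα : IsAdelicOrdering E α) (p : Nat.Primes) (n : ℕ) {y : ℤ_[p]} (hy : y ∈ E p) :
    vp p (∏ k ∈ Finset.range n, (α n p - α k p)) ≤ vp p (∏ k ∈ Finset.range n, (y - α k p)) := by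
  rcases Nat.eq_zero_or_pos n with rfl | hn
  · simp
  classical
  -- Any point of the product set serves to complete `y` away from `p`.
  have hz : Function.update (α 0) p y ∈ prodSet E := fun q _ => by
    rcases eq_or_ne q p with rfl | hq
    · rwa [Function.update_self]
    · rw [Function.update_of_ne hq]
      exact hα.mem 0 q trivial
  have h := (hα.isLeast p n hn).2 ⟨_, hz, rfl⟩
  simpa only [Finset.prod_apply, Pi.sub_apply, Function.update_self] using h

/-- An infinite `E p` has a point distinct from the first `n` terms; the finite valuation of its
product bounds the minimal one. -/
theorem prod_sub_ne_zero (hα : IsAdelicOrdering E α)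
    (hinf : ∀ p : Nat.Primes, (E p).Infinite) (p : Nat.Primes) (n : ℕ) :
    ∏ k ∈ Finset.range n, (α n p - α k p) ≠ 0 := by
  classical
  obtain ⟨y, hy, hyn⟩ := (hinf p).exists_notMem_finset ((Finset.range n).image fun k => α k p)
  have hy0 : ∏ k ∈ Finset.range n, (y - α k p) ≠ 0 := Finset.prod_ne_zero_iff.2 fun k hk h =>
    hyn (Finset.mem_image.2 ⟨k, hk, (sub_eq_zero.1 h).symm⟩)
  intro h
  have hle := hα.vp_prod_le p n hy
  rw [(vp_eq_top_iff _).2 h, top_le_iff, vp_eq_top_iff] at hle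
  exact hy0 hle

theorem apply_ne (hα : IsAdelicOrdering E α)
    (hinf : ∀ p : Nat.Primes, (E p).Infinite) (p : Nat.Primes) (n k : ℕ) (hk : k < n) : α n p ≠ α k p :=
  sub_ne_zero.1 (Finset.prod_ne_zero_iff.1 (hα.prod_sub_ne_zero hinf p n) k (Finset.mem_range.2 hk))

/-- A unit of 𝔸_f is nonzero at every p and a unit of ℤ_p at almost every p; the latter holds
because a factor of a unit is a unit. -/
theorem isUnit_sub (hα : IsAdelicOrdering E α)
    (hinf : ∀ p : Nat.Primes, (E p).Infinite) (n k : ℕ) (hk : k < n) :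
    IsUnit (incl (α n) - incl (α k)) := by
  rw [← map_sub, RestrictedProduct.isUnit_iff]
  refine ⟨fun p => isUnit_iff_ne_zero.2 ?_, ?_⟩
  · change ((α n p - α k p : ℤ_[p]) : ℚ_[p]) ≠ 0
    rw [Ne, PadicInt.coe_eq_zero, sub_eq_zero]
    exact hα.apply_ne hinf p n k hk
  · filter_upwards [hα.eventually_zero n (by omega)] with p hp
    rw [vp_eq_zero_iff, Finset.prod_apply, IsUnit.prod_iff] at hp
    exact ⟨(α n p - α k p).2, hp k (Finset.mem_range.2 hk)⟩

/-- The values of the polynomials `g_n` on `∏_p E_p`, componentwise. -/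
theorem exists_eval_eq (hα : IsAdelicOrdering E α) (hinf : ∀ p : Nat.Primes, (E p).Infinite) :
    ∃ q : ∀ p : Nat.Primes, ℕ → ℤ_[p] → ℤ_[p],
      (∀ p n, ∀ y ∈ E p, q p n y * ∏ k ∈ Finset.range n, (α n p - α k p) =
        ∏ k ∈ Finset.range n, (y - α k p)) ∧
      ∀ n, ∀ y ∈ prodSet E,
        (orderingPoly α n).eval (incl y) = incl fun p => q p n (y p) := by
  -- Membership stands inside the existential so that `choose` yields quotients defined on all of
  -- ℤ_p; off `E p` they are irrelevant.
  have h : ∀ (p : Nat.Primes) (n : ℕ) (y : ℤ_[p]), ∃ z : ℤ_[p], y ∈ E p →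
      z * ∏ k ∈ Finset.range n, (α n p - α k p) = ∏ k ∈ Finset.range n, (y - α k p) :=
    fun p n y => by
      by_cases hy : y ∈ E p
      · obtain ⟨z, hz⟩ := dvd_of_vp_le (hα.prod_sub_ne_zero hinf p n) (hα.vp_prod_le p n hy)
        exact ⟨z, fun _ => by rw [hz, mul_comm]⟩
      · exact ⟨0, fun hy' => absurd hy' hy⟩
  choose q hq using h
  refine ⟨q, hq, fun n y hy => ?_⟩
  refine (isUnit_prod_sub (K := FinAdeles) (hα.isUnit_sub hinf) n).mul_right_cancel ?_
  refine (eval_newtonPoly_mul (K := FinAdeles) (hα.isUnit_sub hinf) n (incl y)).trans ?_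
  change ∏ k ∈ Finset.range n, (incl y - incl (α k)) =
    incl _ * ∏ k ∈ Finset.range n, (incl (α n) - incl (α k))
  simp only [← map_sub, ← map_prod, ← map_mul]
  congr 1
  funext p
  simpa only [Finset.prod_apply, Pi.mul_apply, Pi.sub_apply] using (hq p n (y p) (hy p trivial)).symm

theorem exists_basis (hα : IsAdelicOrdering E α) (hinf : ∀ p : Nat.Primes, (E p).Infinite) :
    ∃ b : Module.Basis ℕ ZHat (intPoly E), ∀ n, (b n : FinAdeles[X]) = orderingPoly α n := by
  obtain ⟨q, -, hq⟩ := hα.exists_eval_eq hinf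
  have hint : ∀ n, ∀ y ∈ prodSet E, (newtonPoly FinAdeles α n).eval (algebraMap ZHat FinAdeles y) ∈
      (algebraMap ZHat FinAdeles).range := fun n y hy => ⟨_, (hq n y hy).symm⟩
  have hu := hα.isUnit_sub hinf
  have : Nontrivial FinAdeles := incl_injective.nontrivial
  let v : ℕ → intPoly E := fun n => ⟨orderingPoly α n, fun y hy => hint n y hy⟩
  have hli : LinearIndependent ZHat v :=
    LinearIndependent.of_comp (intPoly E).subtype
      (linearIndependent_newtonPoly (K := FinAdeles) hu incl_injective)
  refine ⟨Module.Basis.mk hli ?_, fun n => by rw [Module.Basis.mk_apply]⟩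
  rintro ⟨f, hf⟩ -
  obtain ⟨d, b, hb⟩ := exists_eq_sum_smul_newtonPoly (K := FinAdeles) hu hα.mem hint f hf
  have : (⟨f, hf⟩ : intPoly E) = ∑ n ∈ Finset.range d, b n • v n := by
    refine Subtype.ext ?_
    rw [Submodule.coe_sum]
    exact hb
  rw [this]
  exact sum_mem fun n _ => Submodule.smul_mem _ _ (Submodule.subset_span ⟨n, rfl⟩)

/-- At α_n the partial sums are constant as soon as they include the term `n`, so the limit is that
constant. -/
theorem incl_coeff_eq (hα : IsAdelicOrdering E α) (hinf : ∀ p : Nat.Primes, (E p).Infinite)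
    {φ : ∀ p : Nat.Primes, C(E p, ℤ_[p])} {c : ℕ → ZHat}
    (hc : IsExpansion α φ c) (n : ℕ) :
    incl (c n) = incl (prodFun φ ⟨α n, hα.mem n⟩) -
      ∑ k ∈ Finset.range n, c k • (orderingPoly α k).eval (incl (α n)) := by
  rw [eq_sub_iff_add_eq']
  refine tendsto_nhds_unique (tendsto_const_nhds.congr' ?_)
    (hc.tendstoUniformly.tendsto_at ⟨α n, hα.mem n⟩)
  filter_upwards [eventually_gt_atTop n] with N hN
  exact (sum_mul_eval_newtonPoly (K := FinAdeles) (hα.isUnit_sub hinf) (fun k => incl (c k))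
    hN).symm

theorem coeff_eq (hα : IsAdelicOrdering E α) (hinf : ∀ p : Nat.Primes, (E p).Infinite)
    {φ : ∀ p : Nat.Primes, C(E p, ℤ_[p])} {c : ℕ → ZHat} (hc : IsExpansion α φ c)
    {q : ∀ p : Nat.Primes, ℕ → ℤ_[p] → ℤ_[p]}
    (hq : ∀ n, ∀ y ∈ prodSet E, (orderingPoly α n).eval (incl y) = incl fun p => q p n (y p))
    (n : ℕ) : c n = prodFun φ ⟨α n, hα.mem n⟩ -
      ∑ k ∈ Finset.range n, c k * fun p => q p k (α n p) := by
  apply incl_injective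
  rw [hα.incl_coeff_eq hinf hc n, map_sub, map_sum]
  congr 1
  refine Finset.sum_congr rfl fun k _ => ?_
  rw [hq k _ (hα.mem n), map_mul, Algebra.smul_def]
  rfl

theorem exists_isExpansion (hα : IsAdelicOrdering E α) (hinf : ∀ p : Nat.Primes, (E p).Infinite)
    (hcompact : ∀ p, IsCompact (E p)) (φ : ∀ p : Nat.Primes, C(E p, ℤ_[p])) :
    ∃ c : ℕ → ZHat, IsExpansion α φ c := by
  obtain ⟨q, hq, heval⟩ := hα.exists_eval_eq hinf
  let c : ℕ → ZHat := newtonCoeff (fun k n p => q p k (α n p))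
    (fun n => prodFun φ ⟨α n, hα.mem n⟩)
  have hc : ∀ (p : Nat.Primes) (n : ℕ), c n p = φ p ⟨α n p, hα.mem n p trivial⟩ -
      ∑ k ∈ Finset.range n, c k p * q p k (α n p) := fun p n => by
    have h := congrFun (newtonCoeff_eq (fun k n p => q p k (α n p))
      (fun n => prodFun φ ⟨α n, hα.mem n⟩) n) p
    simp only [Pi.sub_apply, Finset.sum_apply, Pi.mul_apply] at h
    exact h
  have hdvd := fun p => exists_forall_pow_dvd_newton (a := fun n => α n p) (hcompact p)
    (fun n => hα.mem n p trivial) (hα.apply_ne hinf p) (hq p) (φ p) (c := fun n => c n p) (hc p)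
  refine ⟨c, ?_, ?_⟩
  · refine tendsto_pi_nhds.2 fun p => Metric.tendsto_atTop.2 fun ε hε => ?_
    obtain ⟨k, hk⟩ := PadicInt.exists_pow_neg_lt p hε
    obtain ⟨d, hd⟩ := hdvd p k
    refine ⟨d, fun N hN => ?_⟩
    rw [Pi.zero_apply, dist_zero_right]
    exact ((pow_dvd_iff_norm_le _ _).1 (hd N hN).1).trans_lt hk
  · have hunif : TendstoUniformly (fun (N : ℕ) (y : prodSet E) =>
        ∑ n ∈ Finset.range N, c n * fun p => q p n ((y : ZHat) p)) (prodFun φ) atTop := by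
      -- The threshold `d` below may depend on `p`.
      refine tendstoUniformly_pi_iff.2 fun p => Metric.tendstoUniformly_iff.2 fun ε hε => ?_
      obtain ⟨k, hk⟩ := PadicInt.exists_pow_neg_lt p hε
      obtain ⟨d, hd⟩ := hdvd p k
      filter_upwards [eventually_ge_atTop d] with N hN y
      rw [dist_eq_norm, Finset.sum_apply]
      exact ((pow_dvd_iff_norm_le _ _).1 ((hd N hN).2 ⟨(y : ZHat) p, y.2 p trivial⟩)).trans_lt hk
    convert uniformContinuous_incl.comp_tendstoUniformly hunif using 1
    swap
    · rfl
    funext N y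
    simp only [Function.comp_apply, map_sum]
    refine Finset.sum_congr rfl fun n _ => ?_
    rw [heval n _ y.2, map_mul, Algebra.smul_def]
    rfl

theorem existsUnique_isExpansion (hα : IsAdelicOrdering E α)
    (hinf : ∀ p : Nat.Primes, (E p).Infinite) (hcompact : ∀ p, IsCompact (E p))
    (φ : ∀ p : Nat.Primes, C(E p, ℤ_[p])) : ∃! c : ℕ → ZHat, IsExpansion α φ c := by
  obtain ⟨c, hc⟩ := hα.exists_isExpansion hinf hcompact φ
  refine ⟨c, hc, fun c' hc' => funext fun n => incl_injective ?_⟩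
  induction n using Nat.strong_induction_on with
  | _ n ih =>
    rw [hα.incl_coeff_eq hinf hc, hα.incl_coeff_eq hinf hc']
    congr 1
    exact Finset.sum_congr rfl fun k hk => by
      rw [incl_injective (ih k (Finset.mem_range.1 hk))]

theorem iInf_vp_eq (hα : IsAdelicOrdering E α) (hinf : ∀ p : Nat.Primes, (E p).Infinite)
    (hcompact : ∀ p, IsCompact (E p)) {φ : ∀ p : Nat.Primes, C(E p, ℤ_[p])} {c : ℕ → ZHat}
    (hc : IsExpansion α φ c) (p : Nat.Primes) :
    ⨅ n : ℕ, vp p (c n p) = ⨅ y : prodSet E, vp p (prodFun φ y p) := by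
  obtain ⟨q, hq, heval⟩ := hα.exists_eval_eq hinf
  have htri : ∀ n : ℕ, c n p = φ p ⟨α n p, hα.mem n p trivial⟩ -
      ∑ k ∈ Finset.range n, c k p * q p k (α n p) := fun n => by
    have h := congrFun (hα.coeff_eq hinf hc heval n) p
    simp only [Pi.sub_apply, Finset.sum_apply, Pi.mul_apply] at h
    exact h
  -- It suffices to compare divisibility by p^d: values inherit it from a partial sum congruent to
  -- `φ` modulo p^d, coefficients from the triangular system.
  refine ENat.eq_of_forall_natCast_le_iff fun d => ?_
  simp only [le_iInf_iff, natCast_le_vp_iff]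
  constructor
  · intro h y
    obtain ⟨N, hN⟩ := exists_forall_pow_dvd_newton (a := fun n => α n p) (hcompact p)
      (fun n => hα.mem n p trivial) (hα.apply_ne hinf p) (hq p) (φ p) (c := fun n => c n p) htri d
    have h1 := (hN N le_rfl).2 ⟨(y : ZHat) p, y.2 p trivial⟩
    exact (dvd_sub_left (Finset.dvd_sum fun n _ => (h n).mul_right _)).1 h1
  · intro h n
    rw [← Ideal.mem_span_singleton]
    exact mem_of_triangular (t := fun k n => q p k (α n p)) htri
      (fun n => Ideal.mem_span_singleton.2 (h ⟨α n, hα.mem n⟩)) n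

end IsAdelicOrdering

end Ordering

end

end AdelicBK

theorem mainTheorem1 (E : ∀ p : Nat.Primes, Set ℤ_[p])
    (hcompact : IsCompact (AdelicBK.prodSet E))
    (hinf : ∀ p : Nat.Primes, (E p).Infinite)
    (hmod : ∀ n : ℕ, ∀ᶠ p : Nat.Primes in Filter.cofinite,
      n < ((PadicInt.toZMod (p := (p : ℕ))) '' E p).ncard) :
    (∃ α : ℕ → AdelicBK.ZHat, AdelicBK.IsAdelicOrdering E α) ∧
    ∀ (α : ℕ → AdelicBK.ZHat) (hα : AdelicBK.IsAdelicOrdering E α),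
      (∀ n, ∀ k < n, IsUnit (AdelicBK.incl (α n) - AdelicBK.incl (α k))) ∧
      (∃ b : Module.Basis ℕ AdelicBK.ZHat (AdelicBK.intPoly E),
        ∀ n, (b n : Polynomial AdelicBK.FinAdeles) = AdelicBK.orderingPoly α n) ∧
      ∀ φ : ∀ p : Nat.Primes, C(E p, ℤ_[p]),
        (∃! c : ℕ → AdelicBK.ZHat, AdelicBK.IsExpansion α φ c) ∧
        ∀ c : ℕ → AdelicBK.ZHat, AdelicBK.IsExpansion α φ c →
          (∀ n, AdelicBK.incl (c n) = AdelicBK.incl (AdelicBK.prodFun φ ⟨α n, hα.mem n⟩) -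
            ∑ k ∈ Finset.range n,
              c k • (AdelicBK.orderingPoly α k).eval (AdelicBK.incl (α n))) ∧
          ∀ p : Nat.Primes, (⨅ n : ℕ, AdelicBK.vp p (c n p)) =
            (⨅ y : AdelicBK.prodSet E, AdelicBK.vp p (AdelicBK.prodFun φ y p)) := by
  have hE : ∀ p, IsCompact (E p) := fun p => by
    -- Nonemptiness makes each projection of the product map onto `E p`.
    have hne : (AdelicBK.prodSet E).Nonempty :=
      Set.univ_pi_nonempty_iff.2 fun q => (hinf q).nonempty
    rw [← Set.eval_image_univ_pi (i := p) hne]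
    exact hcompact.image (continuous_apply p)
  refine ⟨AdelicBK.exists_isAdelicOrdering hinf hmod, fun α hα =>
    ⟨hα.isUnit_sub hinf, hα.exists_basis hinf, fun φ =>
      ⟨hα.existsUnique_isExpansion hinf hE φ, fun c hc =>
        ⟨hα.incl_coeff_eq hinf hc, hα.iInf_vp_eq hinf hE hc⟩⟩⟩⟩
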